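/- **Setting.** Let $n,m,N\in\mathbb N$, $B\in\mathbb R$, $\delta\in(0,1)$, let $\mathcal X\subset\mathbb R^n$, $\mathcal U\subset\mathbb R^m$, and consider the system $\dot x=f(x)+G(x)u$, $f=\hat f+d$, with $x\in\mathcal X$, $u\in\mathcal U$, where $\hat f:\mathcal X\to\mathbb R^n$ and $G:\mathcal X\to\mathbb R^{n\times m}$ are known and $d:\mathcal X\to\mathbb R^n$ is an unknown disturbance, each coordinate of which has norm at most $B$ in the reproducing kernel Hilbert space of a kernel $k$ on $\mathcal X$. A training set $(x_i,y_i)_{i=1}^N$ is given, with (possibly random) $x_i\in\mathcal X$, $y_i=d(x_i)+\upsilon_i$ and $\upsilon_i$ i.i.d. $\mathcal N(0,\sigma_{noise}^2I_n)$, $\sigma_{noise}>0$. With $K=(k(x_i,x_j))_{i,j}$, $k_N(x)=(k(x_i,x))_i$, $A=K+\sigma_{noise}^2I$, put, for $j=1,\dots,n$, $$\mu_j(x)=k_N(x)^TA^{-1}\big((y_i)_j\big)_{i=1}^N,\quad \sigma^2(x)=k(x,x)-k_N(x)^TA^{-1}k_N(x),$$ $$\mathcal D_c(x)=\{v\in\mathbb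 R^n:\ |v_j-\mu_j(x)|\le c\,\sigma(x)\ \text{for all } j\}.$$ A real number $c$ is called a *$(1-\delta)$-confidence parameter* if, with probability at least $1-\delta$, $d(x)\in\mathcal D_c(x)$ for all $x\in\mathcal X$. Let $h:\mathbb R^n\to\mathbb R$ be $C^1$ and $\mathcal S=\{x\in\mathcal X: h(x)\ge0\}$. It is a *zeroing control barrier function* on $\mathcal E$, $\mathcal S\subseteq\mathcal E\subseteq\mathcal X$, with a strictly increasing $\kappa:\mathbb R\to\mathbb R$, $\kappa(0)=0$, if $\sup_{u\in\mathcal U}[\nabla h(x)^T(f(x)+G(x)u)+\kappa(h(x))]\ge0$ for all $x\in\mathcal E$. Put $$K_{rzbf}(x)=\Big\{u\in\mathcal U:\ \inf_{v\in\mathcal D_c(x)}\big[\nabla h(x)^T(\hat f(x)+v+G(x)u)+\kappa(h(x))\big]\ge0\Big\}.$$ **Lemma.** (a) There is $c_0\ge0$, depending only on $n,N,B,\delta$, such that in every such setting every $c\ge c_0$ is a $(1-\delta)$-confidence parameter. (b) Let $c$ be any $(1-\delta)$-confidence parameter, let $h$ be a zeroing control barrier function on some $\mathcal E$ with function $\kappa$,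 and let $W\supseteq\mathcal S$ be relatively open in $\mathcal X$ (for instance $W=\mathcal X$). Then, with probability at least $1-\delta$, inputs from $K_{rzbf}$ render $\mathcal S$ forward invariant: for every $T\in(0,\infty]$, every input $u:[0,T)\to\mathcal U$ and every continuous $x:[0,T)\to\mathcal X$ whose right derivative at each $t$ is $f(x(t))+G(x(t))u(t)$, if $x(0)\in\mathcal S$ and $u(t)\in K_{rzbf}(x(t))$ whenever $x(t)\in W$, then $x(t)\in\mathcal S$ for all $t\in[0,T)$. Here an event that may fail to be measurable is said to have probability at least $p$ if it contains a measurable event of probability at least $p$. -/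

import Mathlib

open MeasureTheory ProbabilityTheory
open scoped Matrix

noncomputable section

namespace RobustCBF

/-- `ℝⁿ` with its Euclidean norm. -/
abbrev Vec (n : ℕ) : Type := EuclideanSpace ℝ (Fin n)

/-! ### Gaussian process regression -/

section GP

variable {X : Type*} (H : Type*) [NormedAddCommGroup H] [InnerProductSpace ℝ H]
  [CompleteSpace H] [RKHS ℝ H X ℝ] {n N : ℕ}

/-- The scalar reproducing kernel `k(x, x')` of the reproducing kernel Hilbert space `H` of real
functions on `X`. -/
def ker (x x' : X) : ℝ := RKHS.kernel H x x' 1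

/-- The matrix `K + σ² I`, with `K i j = k(xᵢ, xⱼ)`. -/
def regGram (s : ℝ) (xs : Fin N → X) : Matrix (Fin N) (Fin N) ℝ :=
  Matrix.of (fun i j => ker H (xs i) (xs j)) + s ^ 2 • (1 : Matrix (Fin N) (Fin N) ℝ)

/-- The vector of the `k(xᵢ, x)`. -/
def kerVec (xs : Fin N → X) (x : X) : Fin N → ℝ := fun i => ker H (xs i) x

/-- The posterior mean at `x`, for scalar observations `y` at the points `xs` with noise standard
deviation `s`. -/
def postMean (s : ℝ) (xs : Fin N → X) (y : Fin N → ℝ) (x : X) : ℝ :=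
  kerVec H xs x ⬝ᵥ ((regGram H s xs)⁻¹ *ᵥ y)

/-- The posterior variance at `x`. -/
def postVar (s : ℝ) (xs : Fin N → X) (x : X) : ℝ :=
  ker H x x - kerVec H xs x ⬝ᵥ ((regGram H s xs)⁻¹ *ᵥ kerVec H xs x)

/-- The posterior standard deviation at `x`. -/
def postStd (s : ℝ) (xs : Fin N → X) (x : X) : ℝ := √(postVar H s xs x)

/-- The set of vectors with `μⱼ(x) - c σ(x) ≤ vⱼ ≤ μⱼ(x) + c σ(x)` in each coordinate `j`, where a
separate Gaussian process is fitted to each coordinate of the vector observations `ys`. -/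
def confSet (s c : ℝ) (xs : Fin N → X) (ys : Fin N → Vec n) (x : X) : Set (Vec n) :=
  {v | ∀ j, postMean H s xs (fun i => ys i j) x - c * postStd H s xs x ≤ v j ∧
    v j ≤ postMean H s xs (fun i => ys i j) x + c * postStd H s xs x}

end GP

/-! ### Control-affine systems and barrier functions -/

section Control

variable {n m : ℕ} {X : Set (Vec n)}

/-- The right-hand side `f(x) + G(x) u`. -/
def vectorField (f : X → Vec n) (G : X → Matrix (Fin n) (Fin m) ℝ) (x : X) (u : Vec m) : Vec n :=
  f x + Matrix.toEuclideanLin (G x) u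

/-- The derivative `(∂h/∂x)(x) v` of `h` at `x` along the velocity `v`. -/
def lieDeriv (h : Vec n → ℝ) (x v : Vec n) : ℝ := fderiv ℝ h x v

/-- The safety set `{x ∈ X | h x ≥ 0}`. -/
def safeSet (X : Set (Vec n)) (h : Vec n → ℝ) : Set X := {x | 0 ≤ h x}

/-- `h` is a zeroing control barrier function on `E`, with extended class-`𝒦` function `κ`, for the
system `x' = f(x) + G(x) u`, `u ∈ U`. The supremum is taken in the extended reals. -/
structure IsZCBF (f : X → Vec n) (G : X → Matrix (Fin n) (Fin m) ℝ) (U : Set (Vec m))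
    (h : Vec n → ℝ) (κ : ℝ → ℝ) (E : Set X) : Prop where
  contDiff : ContDiff ℝ 1 h
  subset : safeSet X h ⊆ E
  strictMono : StrictMono κ
  map_zero : κ 0 = 0
  sup_nonneg : ∀ x ∈ E,
    0 ≤ ⨆ u ∈ U, ((lieDeriv h x (vectorField f G x u) + κ (h x) : ℝ) : EReal)

/-- The robust safe control set: the inputs `u ∈ U` for which
`inf_{v ∈ D(x)} [(∂h/∂x)(x) (fhat(x) + v + G(x) u) + κ(h(x))] ≥ 0`, where `D x` is the set of
possible values of the disturbance at `x`. -/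
def robustSafeInputs (fhat : X → Vec n) (G : X → Matrix (Fin n) (Fin m) ℝ) (U : Set (Vec m))
    (h : Vec n → ℝ) (κ : ℝ → ℝ) (D : X → Set (Vec n)) (x : X) : Set (Vec m) :=
  {u | u ∈ U ∧ 0 ≤ ⨅ v ∈ D x,
    ((lieDeriv h x (vectorField fhat G x u + v) + κ (h x) : ℝ) : EReal)}

/-- The time interval `[0, T)`, where `T` may be `∞`. -/
def timeInterval (T : EReal) : Set ℝ := {t | 0 ≤ t ∧ (t : EReal) < T}

/-- `x` is a trajectory of `x' = f(x) + G(x) u` in `X` on `[0, T)` under the input signal `u`, with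
values in `U`. Derivatives are taken from the right, so that piecewise constant inputs are
covered as well as classical solutions. -/
structure IsTrajectory (f : X → Vec n) (G : X → Matrix (Fin n) (Fin m) ℝ) (U : Set (Vec m))
    (T : EReal) (x : ℝ → X) (u : ℝ → Vec m) : Prop where
  continuousOn : ContinuousOn x (timeInterval T)
  input_mem : ∀ t ∈ timeInterval T, u t ∈ U
  hasDeriv : ∀ t ∈ timeInterval T,
    HasDerivWithinAt (fun r => (x r : Vec n)) (vectorField f G (x t) (u t)) (Set.Ici t) t

/-- Inputs taken from `K` on `W` render `S` forward invariant: every trajectory starting in `S`, on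
whatever interval `[0, T)` it is defined, stays in `S`, provided its input satisfies
`u(t) ∈ K(x(t))` whenever `x(t) ∈ W`. This covers every feedback law with `u(t, x) ∈ K(x)`. -/
def RendersForwardInvariant (f : X → Vec n) (G : X → Matrix (Fin n) (Fin m) ℝ) (U : Set (Vec m))
    (K : X → Set (Vec m)) (W S : Set X) : Prop :=
  ∀ (T : EReal) (x : ℝ → X) (u : ℝ → Vec m), IsTrajectory f G U T x u → x 0 ∈ S →
    (∀ t ∈ timeInterval T, x t ∈ W → u t ∈ K (x t)) → ∀ t ∈ timeInterval T, x t ∈ S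

end Control

/-- The event `A` has probability at least `p`; as `A` need not be measurable, this is said through
a measurable subset (inner probability). -/
def ProbAtLeast {Ω : Type*} [MeasurableSpace Ω] (P : Measure Ω) (p : ℝ) (A : Set Ω) : Prop :=
  ∃ A' ⊆ A, MeasurableSet A' ∧ p ≤ P.real A'

/-- The confidence set `D(x)` computed at outcome `ω` from the training set of the `N` pairs
`(xᵢ, yᵢ)`, `yᵢ = d(xᵢ) + vᵢ`, with sampled states `xᵢ = xs i ω` and noise `vᵢ = v i ω`. -/
def learnedSet {Ω X : Type*} (H : Type*) [NormedAddCommGroup H] [InnerProductSpace ℝ H]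
    [CompleteSpace H] [RKHS ℝ H X ℝ] {n N : ℕ} (d : X → Vec n) (s c : ℝ) (xs : Fin N → Ω → X)
    (v : Fin N → Ω → Vec n) (ω : Ω) (x : X) : Set (Vec n) :=
  confSet H s c (fun i => xs i ω) (fun i => d (xs i ω) + v i ω) x

/-- `c` is a parameter giving confidence `1 - δ`: with probability at least `1 - δ`, the true
disturbance satisfies `d(x) ∈ D(x)` for all `x`. -/
def IsConfidenceParam {Ω X : Type*} [MeasurableSpace Ω] (P : Measure Ω) (H : Type*)
    [NormedAddCommGroup H] [InnerProductSpace ℝ H] [CompleteSpace H] [RKHS ℝ H X ℝ] {n N : ℕ}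
    (d : X → Vec n) (s : ℝ) (xs : Fin N → Ω → X) (v : Fin N → Ω → Vec n) (δ c : ℝ) : Prop :=
  ProbAtLeast P (1 - δ) {ω | ∀ x, d x ∈ learnedSet H d s c xs v ω x}

end RobustCBF

end

namespace RobustCBF

open Set Filter Topology
open scoped RealInnerProductSpace

section GP

variable {X : Type*} (H : Type*) [NormedAddCommGroup H] [InnerProductSpace ℝ H]
  [CompleteSpace H] [RKHS ℝ H X ℝ] {N : ℕ}

lemma ker_eq_inner (x y : X) :
    ker H x y = ⟪RKHS.kerFun H x (1 : ℝ), RKHS.kerFun H y (1 : ℝ)⟫ := by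
  have := RKHS.kernel_inner H x y (1 : ℝ) (1 : ℝ)
  rw [real_inner_comm, ← this]
  simp [ker]

lemma posDef_regGram {s : ℝ} (hs : 0 < s) (xs : Fin N → X) : (regGram H s xs).PosDef := by
  have hK : Matrix.of (fun i j => ker H (xs i) (xs j)) =
      Matrix.gram ℝ (fun i => RKHS.kerFun H (xs i) (1 : ℝ)) := by
    ext i j
    simp only [Matrix.of_apply, Matrix.gram_apply, ker_eq_inner]
  rw [regGram, hK]
  exact Matrix.PosDef.posSemidef_add (Matrix.posSemidef_gram ℝ _)
    (Matrix.PosDef.one.smul (by positivity))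

/-- The coefficients of the best linear predictor at `x` from the observations at `xs`. -/
noncomputable def postWeights (s : ℝ) (xs : Fin N → X) (x : X) : Fin N → ℝ :=
  (regGram H s xs)⁻¹ *ᵥ kerVec H xs x

/-- The difference between the representer of evaluation at `x` and its prediction from the
representers of evaluation at the points `xs`. -/
noncomputable def postResidual (s : ℝ) (xs : Fin N → X) (x : X) : H :=
  RKHS.kerFun H x (1 : ℝ) - ∑ i, postWeights H s xs x i • RKHS.kerFun H (xs i) (1 : ℝ)

lemma regGram_mulVec_postWeights {s : ℝ} (hs : 0 < s) (xs : Fin N → X) (x : X) :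
    regGram H s xs *ᵥ postWeights H s xs x = kerVec H xs x := by
  have hdet := (Matrix.isUnit_iff_isUnit_det _).1 (posDef_regGram H hs xs).isUnit
  rw [postWeights, Matrix.mulVec_mulVec, Matrix.mul_nonsing_inv _ hdet, Matrix.one_mulVec]

lemma postMean_eq_postWeights_dotProduct {s : ℝ} (hs : 0 < s) (xs : Fin N → X) (y : Fin N → ℝ)
    (x : X) : postMean H s xs y x = postWeights H s xs x ⬝ᵥ y := by
  have hsymm : ((regGram H s xs)⁻¹)ᵀ = (regGram H s xs)⁻¹ := by
    simpa using (posDef_regGram H hs xs).isHermitian.inv.eq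
  rw [postMean, postWeights, Matrix.dotProduct_mulVec, ← Matrix.mulVec_transpose, hsymm]

lemma postVar_eq_norm_sq_add {s : ℝ} (hs : 0 < s) (xs : Fin N → X) (x : X) :
    postVar H s xs x =
      ‖postResidual H s xs x‖ ^ 2 + s ^ 2 * ∑ i, postWeights H s xs x i ^ 2 := by
  have hA := congrArg (postWeights H s xs x ⬝ᵥ ·) (regGram_mulVec_postWeights H hs xs x)
  simp only [regGram, Matrix.add_mulVec, Matrix.smul_mulVec, Matrix.one_mulVec, dotProduct_add,
    dotProduct_smul, smul_eq_mul] at hA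
  have hsq : ‖∑ i, postWeights H s xs x i • RKHS.kerFun H (xs i) (1 : ℝ)‖ ^ 2 =
      postWeights H s xs x ⬝ᵥ
        (Matrix.of (fun i j => ker H (xs i) (xs j)) *ᵥ postWeights H s xs x) := by
    rw [← real_inner_self_eq_norm_sq, sum_inner]
    simp only [dotProduct, Matrix.mulVec, inner_sum, real_inner_smul_left, real_inner_smul_right,
      Matrix.of_apply, ker_eq_inner, Finset.mul_sum]
    refine Finset.sum_congr rfl fun i _ => Finset.sum_congr rfl fun j _ => by ring
  have hcross : ⟪RKHS.kerFun H x (1 : ℝ),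
      ∑ i, postWeights H s xs x i • RKHS.kerFun H (xs i) (1 : ℝ)⟫ =
      postWeights H s xs x ⬝ᵥ kerVec H xs x := by
    rw [real_inner_comm, sum_inner]
    simp only [dotProduct, kerVec, real_inner_smul_left, ker_eq_inner]
  have hself : ∑ i, postWeights H s xs x i ^ 2 =
      postWeights H s xs x ⬝ᵥ postWeights H s xs x := by
    simp only [dotProduct, sq]
  rw [postResidual, norm_sub_sq_real, hsq, hcross, hself, ← real_inner_self_eq_norm_sq,
    ← ker_eq_inner, postVar, dotProduct_comm (kerVec H xs x),
    show (regGram H s xs)⁻¹ *ᵥ kerVec H xs x = postWeights H s xs x from rfl]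
  linarith

lemma norm_postResidual_le {s : ℝ} (hs : 0 < s) (xs : Fin N → X) (x : X) :
    ‖postResidual H s xs x‖ ≤ postStd H s xs x := by
  refine Real.le_sqrt_of_sq_le ?_
  rw [postVar_eq_norm_sq_add H hs]
  have : 0 ≤ ∑ i, postWeights H s xs x i ^ 2 := Finset.sum_nonneg fun i _ => sq_nonneg _
  nlinarith [mul_nonneg (sq_nonneg s) this]

lemma mul_sqrt_sum_sq_postWeights_le {s : ℝ} (hs : 0 < s) (xs : Fin N → X) (x : X) :
    s * √(∑ i, postWeights H s xs x i ^ 2) ≤ postStd H s xs x := by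
  refine Real.le_sqrt_of_sq_le ?_
  have : 0 ≤ ∑ i, postWeights H s xs x i ^ 2 := Finset.sum_nonneg fun i _ => sq_nonneg _
  rw [postVar_eq_norm_sq_add H hs, mul_pow, Real.sq_sqrt this]
  nlinarith [sq_nonneg ‖postResidual H s xs x‖]

variable {H}

lemma apply_sub_postMean {s : ℝ} (hs : 0 < s) (xs : Fin N → X) (g : H) (w : Fin N → ℝ) (x : X) :
    g x - postMean H s xs (fun i => g (xs i) + w i) x =
      ⟪postResidual H s xs x, g⟫ - ∑ i, postWeights H s xs x i * w i := by
  rw [postMean_eq_postWeights_dotProduct H hs, postResidual, inner_sub_left, sum_inner]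
  simp only [dotProduct, real_inner_smul_left, RKHS.kerFun_inner, mul_add,
    Finset.sum_add_distrib]
  simp
  ring

/-- The prediction error of Gaussian process regression is controlled by the posterior standard
deviation, the norm of the unknown function and the size of the noise. -/
theorem abs_sub_postMean_le {s : ℝ} (hs : 0 < s) (xs : Fin N → X) {g : H} {B R : ℝ}
    (hg : ‖g‖ ≤ B) {w : Fin N → ℝ} (hw : √(∑ i, w i ^ 2) ≤ s * R) (x : X) :
    |g x - postMean H s xs (fun i => g (xs i) + w i) x| ≤ (B + R) * postStd H s xs x := by
  have hR : 0 ≤ R := nonneg_of_mul_nonneg_right ((Real.sqrt_nonneg _).trans hw) hs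
  have hσ : 0 ≤ postStd H s xs x := Real.sqrt_nonneg _
  have h₁ : |⟪postResidual H s xs x, g⟫| ≤ B * postStd H s xs x :=
    calc |⟪postResidual H s xs x, g⟫| ≤ ‖postResidual H s xs x‖ * ‖g‖ := abs_real_inner_le_norm _ _
      _ ≤ postStd H s xs x * B := by
          gcongr
          exact norm_postResidual_le H hs xs x
      _ = _ := mul_comm _ _
  have h₂ : |∑ i, postWeights H s xs x i * w i| ≤ R * postStd H s xs x :=
    calc |∑ i, postWeights H s xs x i * w i|
        ≤ √(∑ i, postWeights H s xs x i ^ 2) * √(∑ i, w i ^ 2) := by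
          rw [← Real.sqrt_mul (Finset.sum_nonneg fun i _ => sq_nonneg _)]
          exact Real.abs_le_sqrt (Finset.sum_mul_sq_le_sq_mul_sq _ _ _)
      _ ≤ √(∑ i, postWeights H s xs x i ^ 2) * (s * R) := by gcongr
      _ = R * (s * √(∑ i, postWeights H s xs x i ^ 2)) := by ring
      _ ≤ R * postStd H s xs x := by
          gcongr
          exact mul_sqrt_sum_sq_postWeights_le H hs xs x
  rw [apply_sub_postMean hs]
  exact (abs_sub _ _).trans (by linarith)

end GP

section Probability

variable {Ω : Type*} [MeasurableSpace Ω] {P : Measure Ω}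

lemma ProbAtLeast.mono {p : ℝ} {A A' : Set Ω} (h : ProbAtLeast P p A) (hA : A ⊆ A') :
    ProbAtLeast P p A' := by
  obtain ⟨S, hS, hm, hp⟩ := h
  exact ⟨S, hS.trans hA, hm, hp⟩

lemma probAtLeast_of_measure_compl_le [IsProbabilityMeasure P] {δ : ℝ} (hδ : 0 ≤ δ) {A : Set Ω}
    (h : P Aᶜ ≤ ENNReal.ofReal δ) : ProbAtLeast P (1 - δ) A := by
  refine ⟨(toMeasurable P Aᶜ)ᶜ, compl_subset_comm.1 (subset_toMeasurable P _),
    (measurableSet_toMeasurable P _).compl, ?_⟩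
  rw [probReal_compl_eq_one_sub (measurableSet_toMeasurable P _), measureReal_def,
    measure_toMeasurable]
  have := ENNReal.toReal_le_of_le_ofReal hδ h
  linarith

/-- Chebyshev's inequality for a coordinate of an isotropic centred Gaussian vector. -/
lemma measure_mul_le_abs_coord_le {n : ℕ} {s R : ℝ} (hs : 0 < s) (hR : 0 < R) {v : Ω → Vec n}
    (hv : HasLaw v (multivariateGaussian 0 (s ^ 2 • (1 : Matrix (Fin n) (Fin n) ℝ))) P)
    (j : Fin n) : P {ω | s * R ≤ |v ω j|} ≤ ENNReal.ofReal (1 / R ^ 2) := by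
  have hS : (s ^ 2 • (1 : Matrix (Fin n) (Fin n) ℝ)).PosSemidef :=
    Matrix.PosSemidef.one.smul (by positivity)
  have hm : MeasurableSet {y : Vec n | s * R ≤ |y j|} :=
    measurableSet_le measurable_const (by fun_prop)
  have hmap : P {ω | s * R ≤ |v ω j|} =
      multivariateGaussian 0 (s ^ 2 • (1 : Matrix (Fin n) (Fin n) ℝ)) {y | s * R ≤ |y j|} := by
    rw [← hv.map_eq, Measure.map_apply_of_aemeasurable hv.aemeasurable hm]
    rfl
  have hmem : MemLp (fun y : Vec n => y j) 2
      (multivariateGaussian 0 (s ^ 2 • (1 : Matrix (Fin n) (Fin n) ℝ))) :=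
    (EuclideanSpace.proj (𝕜 := ℝ) j).comp_memLp' IsGaussian.memLp_two_id
  have hint : ∫ y : Vec n, y j
      ∂(multivariateGaussian 0 (s ^ 2 • (1 : Matrix (Fin n) (Fin n) ℝ))) = 0 := by
    have := (EuclideanSpace.proj (𝕜 := ℝ) j).integral_comp_id_comm
      (μ := multivariateGaussian 0 (s ^ 2 • (1 : Matrix (Fin n) (Fin n) ℝ)))
      IsGaussian.integrable_id
    simpa using this
  have hcheb := meas_ge_le_variance_div_sq hmem (mul_pos hs hR)
  rw [variance_eval_multivariateGaussian hS, hint] at hcheb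
  simp only [sub_zero] at hcheb
  rw [hmap]
  refine hcheb.trans (le_of_eq ?_)
  congr 1
  simp only [Matrix.smul_apply, Matrix.one_apply_eq, smul_eq_mul]
  field_simp

/-- With probability at least `1 - δ`, all coordinates of the noise vectors are below a bound that
depends on the noise only through its standard deviation. -/
lemma probAtLeast_abs_noise_le [IsProbabilityMeasure P] {n N : ℕ} {s δ : ℝ} (hs : 0 < s)
    (hδ : 0 < δ) {v : Fin N → Ω → Vec n}
    (hv : ∀ i, HasLaw (v i)
      (multivariateGaussian 0 (s ^ 2 • (1 : Matrix (Fin n) (Fin n) ℝ))) P) :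
    ProbAtLeast P (1 - δ) {ω | ∀ i j, |v i ω j| ≤ s * √((N * n + 1) / δ)} := by
  have hR : 0 < √((N * n + 1) / δ) := Real.sqrt_pos.2 (by positivity)
  refine probAtLeast_of_measure_compl_le hδ.le ?_
  have hsub : {ω | ∀ i j, |v i ω j| ≤ s * √((N * n + 1) / δ)}ᶜ ⊆
      ⋃ ij : Fin N × Fin n, {ω | s * √((N * n + 1) / δ) ≤ |v ij.1 ω ij.2|} := by
    intro ω hω
    simp only [mem_compl_iff, mem_ofPred_eq, not_forall, not_le] at hω
    obtain ⟨i, j, hij⟩ := hω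
    exact mem_iUnion.2 ⟨(i, j), hij.le⟩
  calc P _ ≤ P (⋃ ij : Fin N × Fin n, {ω | s * √((N * n + 1) / δ) ≤ |v ij.1 ω ij.2|}) :=
        measure_mono hsub
    _ ≤ ∑ ij : Fin N × Fin n, P {ω | s * √((N * n + 1) / δ) ≤ |v ij.1 ω ij.2|} :=
        measure_iUnion_fintype_le _ _
    _ ≤ ∑ _ij : Fin N × Fin n, ENNReal.ofReal (1 / √((N * n + 1) / δ) ^ 2) :=
        Finset.sum_le_sum fun ij _ => measure_mul_le_abs_coord_le hs hR (hv ij.1) ij.2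
    _ ≤ ENNReal.ofReal δ := by
        rw [← ENNReal.ofReal_sum_of_nonneg fun _ _ => by positivity]
        refine ENNReal.ofReal_le_ofReal ?_
        rw [Real.sq_sqrt (by positivity)]
        simp only [Finset.sum_const, Finset.card_univ, Fintype.card_prod, Fintype.card_fin,
          nsmul_eq_mul, one_div, inv_div, Nat.cast_mul]
        rw [← mul_div_assoc, div_le_iff₀ (by positivity)]
        nlinarith

/-- An explicit confidence parameter: the bound on the norm of the unknown functions plus a bound
on the noise that holds with probability at least `1 - δ`. -/
theorem isConfidenceParam_of_le [IsProbabilityMeasure P] {X : Type*} {H : Type*}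
    [NormedAddCommGroup H] [InnerProductSpace ℝ H] [CompleteSpace H] [RKHS ℝ H X ℝ] {n N : ℕ}
    {d : X → Vec n} {B : ℝ} (hd : ∀ j, ∃ g : H, ‖g‖ ≤ B ∧ ∀ x, g x = d x j) {s δ c : ℝ}
    (hs : 0 < s) (hδ : 0 < δ) (xs : Fin N → Ω → X) {v : Fin N → Ω → Vec n}
    (hv : ∀ i, HasLaw (v i)
      (multivariateGaussian 0 (s ^ 2 • (1 : Matrix (Fin n) (Fin n) ℝ))) P)
    (hc : B + √N * √((N * n + 1) / δ) ≤ c) : IsConfidenceParam P H d s xs v δ c := by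
  refine (probAtLeast_abs_noise_le hs hδ hv).mono fun ω hω x j => ?_
  obtain ⟨g, hg, hgd⟩ := hd j
  have hw : √(∑ i, v i ω j ^ 2) ≤ s * (√N * √((N * n + 1) / δ)) := by
    refine Real.sqrt_le_iff.2 ⟨by positivity, ?_⟩
    calc ∑ i, v i ω j ^ 2 ≤ ∑ _i : Fin N, (s * √((N * n + 1) / δ)) ^ 2 :=
          Finset.sum_le_sum fun i _ => sq_le_sq' (abs_le.1 (hω i j)).1 (abs_le.1 (hω i j)).2
      _ = √N ^ 2 * (s * √((N * n + 1) / δ)) ^ 2 := by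
          rw [Real.sq_sqrt (Nat.cast_nonneg N)]
          simp
      _ = _ := by ring
  have herr := (abs_sub_postMean_le hs (fun i => xs i ω) hg hw x).trans
    (mul_le_mul_of_nonneg_right hc (Real.sqrt_nonneg _))
  simp only [hgd] at herr
  have herr' := abs_le.1 herr
  simp only [PiLp.add_apply]
  constructor
  · linarith [herr'.2]
  · linarith [herr'.1]

end Probability

section Control

/-- A continuous function that is nonnegative at `a` stays nonnegative on `[a, b]` if, right after
each of its zeros, its right derivative is nonnegative wherever the function is nonpositive. -/
theorem nonneg_of_right_deriv_nonneg {y y' : ℝ → ℝ} {a b : ℝ} (hy : ContinuousOn y (Icc a b))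
    (hy' : ∀ t ∈ Ico a b, HasDerivWithinAt y (y' t) (Ici t) t) (ha : 0 ≤ y a)
    (hbound : ∀ t ∈ Ico a b, 0 ≤ y t → ∀ᶠ r in 𝓝[Icc a b] t, y r ≤ 0 → 0 ≤ y' r)
    (hab : a ≤ b) : 0 ≤ y b := by
  by_contra! hb
  obtain ⟨t₀, ht₀, hmax⟩ : ∃ t₀ ∈ Icc a b ∩ y ⁻¹' Ici 0, ∀ r ∈ Icc a b ∩ y ⁻¹' Ici 0, r ≤ t₀ :=
    (isCompact_Icc.of_isClosed_subset (hy.preimage_isClosed_of_isClosed isClosed_Icc isClosed_Ici)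
      inter_subset_left).exists_isGreatest ⟨a, left_mem_Icc.2 hab, ha⟩
  have ht₀b : t₀ < b := lt_of_le_of_ne ht₀.1.2 fun h => by
    have := ht₀.2
    rw [h] at this
    exact absurd this (not_le.2 hb)
  have hneg : ∀ r ∈ Ioc t₀ b, y r < 0 := fun r hr => by
    by_contra! h
    exact absurd (hmax r ⟨⟨ht₀.1.1.trans hr.1.le, hr.2⟩, h⟩) (not_le.2 hr.1)
  have hzero : y t₀ ≤ 0 := by
    have hlim : Tendsto y (𝓝[Ioc t₀ b] t₀) (𝓝 (y t₀)) :=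
      (hy t₀ ht₀.1).mono_left (nhdsWithin_mono _ (Ioc_subset_Icc_self.trans
        (Icc_subset_Icc_left ht₀.1.1)))
    have : (𝓝[Ioc t₀ b] t₀).NeBot := by
      rw [nhdsWithin_Ioc_eq_nhdsGT ht₀b]
      infer_instance
    exact le_of_tendsto hlim (eventually_nhdsWithin_of_forall fun r hr => (hneg r hr).le)
  obtain ⟨ε, hε, hball⟩ := Metric.mem_nhdsWithin_iff.1 (hbound t₀ ⟨ht₀.1.1, ht₀b⟩ ht₀.2)
  set c := min b (t₀ + ε / 2) with hc_def
  have hc : t₀ < c := lt_min ht₀b (by linarith)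
  have hcb : c ≤ b := min_le_left _ _
  have hcε : c ≤ t₀ + ε / 2 := min_le_right _ _
  have hle := image_le_of_deriv_right_le_deriv_boundary (f := fun r => -y r)
    (f' := fun r => -y' r) (a := t₀) (b := c) (B := fun _ => 0) (B' := fun _ => 0)
    (hy.mono (Icc_subset_Icc ht₀.1.1 hcb)).neg
    (fun r hr => (hy' r ⟨ht₀.1.1.trans hr.1, hr.2.trans_le hcb⟩).neg)
    (by simpa using ht₀.2) continuousOn_const (fun r _ => hasDerivWithinAt_const _ _ _)
    (fun r hr => by
      have hyr : y r ≤ 0 := by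
        rcases hr.1.eq_or_lt with h | h
        · exact h ▸ hzero
        · exact (hneg r ⟨h, hr.2.le.trans hcb⟩).le
      have hmem : r ∈ Icc a b := ⟨ht₀.1.1.trans hr.1, hr.2.le.trans hcb⟩
      have hdist : dist r t₀ < ε := by
        rw [Real.dist_eq, abs_of_nonneg (by linarith [hr.1])]
        linarith [hr.2]
      simpa using hball ⟨hdist, hmem⟩ hyr)
    (right_mem_Icc.2 hc.le)
  have := hneg c ⟨hc, hcb⟩
  linarith

variable {n m : ℕ} {X : Set (Vec n)}

lemma lieDeriv_add_nonneg_of_mem_robustSafeInputs {fhat d : X → Vec n}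
    {G : X → Matrix (Fin n) (Fin m) ℝ} {U : Set (Vec m)} {h : Vec n → ℝ} {κ : ℝ → ℝ}
    {D : X → Set (Vec n)} {x : X} {u : Vec m} (hu : u ∈ robustSafeInputs fhat G U h κ D x)
    (hd : d x ∈ D x) :
    0 ≤ lieDeriv h x (vectorField (fun x => fhat x + d x) G x u) + κ (h x) := by
  have h₀ := le_iInf₂_iff.1 hu.2 (d x) hd
  rw [← EReal.coe_zero, EReal.coe_le_coe_iff] at h₀
  have hv : vectorField (fun x => fhat x + d x) G x u = vectorField fhat G x u + d x := by
    simp only [vectorField]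
    abel
  rwa [hv]

/-- Inputs that are safe for every disturbance in `D` keep the safety set invariant if the true
disturbance is in `D`. -/
theorem rendersForwardInvariant_robustSafeInputs {fhat d : X → Vec n}
    {G : X → Matrix (Fin n) (Fin m) ℝ} {U : Set (Vec m)} {h : Vec n → ℝ} {κ : ℝ → ℝ}
    {D : X → Set (Vec n)} {W : Set X} (hh : ContDiff ℝ 1 h) (hκ : Monotone κ) (hκ0 : κ 0 = 0)
    (hd : ∀ x, d x ∈ D x) (hW : IsOpen W) (hSW : safeSet X h ⊆ W) :
    RendersForwardInvariant (fun x => fhat x + d x) G U (robustSafeInputs fhat G U h κ D) W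
      (safeSet X h) := by
  intro T x u htraj hx0 hu t ht
  have hsub : Icc 0 t ⊆ timeInterval T := fun r hr =>
    ⟨hr.1, (EReal.coe_le_coe_iff.2 hr.2).trans_lt ht.2⟩
  have hxc : ContinuousOn x (Icc 0 t) := htraj.continuousOn.mono hsub
  have hyc : ContinuousOn (fun r => h (x r)) (Icc 0 t) :=
    hh.continuous.comp_continuousOn (continuous_subtype_val.comp_continuousOn hxc)
  refine nonneg_of_right_deriv_nonneg
    (y' := fun r => lieDeriv h (x r) (vectorField (fun x => fhat x + d x) G (x r) (u r)))
    hyc (fun r hr => ?_) hx0 (fun r hr hyr => ?_) ht.1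
  · exact ((hh.differentiable one_ne_zero) (x r)).hasFDerivAt.comp_hasDerivWithinAt r
      (htraj.hasDeriv r (hsub (Ico_subset_Icc_self hr)))
  · have hWr : ∀ᶠ q in 𝓝[Icc 0 t] r, x q ∈ W :=
      (hxc r (Ico_subset_Icc_self hr)).eventually_mem (hW.mem_nhds (hSW hyr))
    filter_upwards [hWr, self_mem_nhdsWithin] with q hq hqt hyq
    have hκq : κ (h (x q)) ≤ 0 := hκ0 ▸ hκ hyq
    have := lieDeriv_add_nonneg_of_mem_robustSafeInputs (hu q (hsub hqt) hq) (hd (x q))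
    linarith

end Control

end RobustCBF

theorem lemma1 (n N : ℕ) (B δ : ℝ) (hδ : δ ∈ Set.Ioo (0 : ℝ) 1) :
    -- a confidence parameter that depends on `n`, `N`, `B`, `δ` only
    ∃ c₀ : ℝ, 0 ≤ c₀ ∧
      -- state space, input set, probability space
      ∀ (m : ℕ) (X : Set (RobustCBF.Vec n)) (U : Set (RobustCBF.Vec m))
        {Ω : Type*} [MeasurableSpace Ω] (P : Measure Ω) [IsProbabilityMeasure P]
        -- RKHS of the kernel, and the disturbance, with coordinates of RKHS norm at most `B`
        (H : Type*) [NormedAddCommGroup H] [InnerProductSpace ℝ H] [CompleteSpace H]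
        [RKHS ℝ H X ℝ] (d : X → RobustCBF.Vec n)
        (_ : ∀ j, ∃ g : H, ‖g‖ ≤ B ∧ ∀ x, g x = d x j)
        -- sampled states and i.i.d. Gaussian noise
        (s : ℝ) (_ : 0 < s) (xs : Fin N → Ω → X) (v : Fin N → Ω → RobustCBF.Vec n)
        (_ : iIndepFun v P)
        (_ : ∀ i, HasLaw (v i)
          (multivariateGaussian 0 (s ^ 2 • (1 : Matrix (Fin n) (Fin n) ℝ))) P),
        (∀ c, c₀ ≤ c → RobustCBF.IsConfidenceParam P H d s xs v δ c) ∧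
        ∀ c, RobustCBF.IsConfidenceParam P H d s xs v δ c →
          ∀ (fhat : X → RobustCBF.Vec n) (G : X → Matrix (Fin n) (Fin m) ℝ)
            (h : RobustCBF.Vec n → ℝ) (κ : ℝ → ℝ) (E : Set X),
            RobustCBF.IsZCBF (fun x => fhat x + d x) G U h κ E →
            ∀ W : Set X, IsOpen W → RobustCBF.safeSet X h ⊆ W →
              RobustCBF.ProbAtLeast P (1 - δ)
                {ω | RobustCBF.RendersForwardInvariant (fun x => fhat x + d x) G U
                  (RobustCBF.robustSafeInputs fhat G U h κ
                    (RobustCBF.learnedSet H d s c xs v ω)) W (RobustCBF.safeSet X h)} := by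
  have hδ0 : 0 < δ := hδ.1
  refine ⟨max 0 (B + √N * √((N * n + 1) / δ)), le_max_left _ _, ?_⟩
  intro m X U Ω _ P _ H _ _ _ _ d hd s hs xs v _ hv
  refine ⟨fun c hc => RobustCBF.isConfidenceParam_of_le hd hs hδ0 xs hv
    ((le_max_right _ _).trans hc), ?_⟩
  intro c hc fhat G h κ E hh W hW hSW
  exact RobustCBF.ProbAtLeast.mono hc fun ω hω =>
    RobustCBF.rendersForwardInvariant_robustSafeInputs hh.contDiff hh.strictMono.monotone
      hh.map_zero hω hW hSW
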